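/- Let $m$ be Lebesgue measure on $\mathbb{R}$ and let $T(x) = x - \frac1x$ be the Boole map (defined for $x\neq 0$; the value at $0$ is irrelevant). For a bounded measurable $G:\mathbb{R}\to\mathbb{C}$ put $$\mathrm{avg}(G) := \lim_{a\to+\infty} \frac{1}{2a}\int_{-a}^{a} G\,dm$$ whenever the limit exists. Let $F:\mathbb{R}\to\mathbb{R}$ be a measurable function such that $\mathrm{avg}(e^{i\theta F})$ exists for every $\theta\in\mathbb{R}$. (a) If $X$ is a real random variable, on some probability space, with characteristic function $\varphi_X(\theta) = \mathrm{avg}(e^{i\theta F})$ for all $\theta \in \mathbb{R}$, then $F\circ T^n$ converges to $X$ in strong distributional sense as $n\to\infty$; that is, for every Borel probability measure $\nu\ll m$ on $\mathbb{R}$, the distribution of $F\circ T^n$ with respect to $\nu$ converges weakly to the distribution of $X$. (b) Such a random variable $X$ exists if and only if the function $\theta\mapsto \mathrm{avg}(e^{i\theta F})$ is continuous at $\theta=0$. -/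

import Mathlib

open MeasureTheory Filter Topology

noncomputable section

namespace Boole

/-- The Boole map `T x = x - 1 / x`. Its value at the single point `0`, where the formula makes
no sense, is `0` by convention; only a countable (hence Lebesgue-null) set of points ever
reaches `0`. -/
def booleMap (x : ℝ) : ℝ := x - 1 / x

/-- The infinite-volume average of `G : ℝ → ℂ` exists and equals `l`:
`(1 / 2a) ∫_{-a}^a G dm → l` as `a → +∞`. (Used for bounded measurable `G`, so that every
integral is a genuine one.) -/
def HasAvg (G : ℝ → ℂ) (l : ℂ) : Prop :=
  Tendsto (fun a : ℝ => ((1 / (2 * a) : ℝ) : ℂ) * ∫ x in (-a)..a, G x) atTop (𝓝 l)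

/-- The infinite-volume average of `G` (meaningful when the limit exists). -/
def avg (G : ℝ → ℂ) : ℂ :=
  limUnder atTop (fun a : ℝ => ((1 / (2 * a) : ℝ) : ℂ) * ∫ x in (-a)..a, G x)

/-- The function `e^{iθF}`. -/
def expObs (F : ℝ → ℝ) (θ : ℝ) (x : ℝ) : ℂ := Complex.exp (Complex.I * θ * F x)

/-- `X`, defined on the probability space `(Ω, P)`, is a real random variable whose characteristic
function is `φ`. -/
def IsRandomVariableWithCharFun {Ω : Type*} [MeasurableSpace Ω] (P : Measure Ω) (X : Ω → ℝ)
    (φ : ℝ → ℂ) : Prop :=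
  Measurable X ∧ ∀ θ : ℝ, charFun (P.map X) θ = φ θ

/-- Convergence in strong distributional sense: for every probability measure `ν` on `ℝ` that is
absolutely continuous with respect to Lebesgue measure, the distribution of `Fₙ` with respect to
`ν` converges (weakly) to that of `X`. -/
def TendstoStrongDistrib (Fn : ℕ → ℝ → ℝ) {Ω : Type*} [MeasurableSpace Ω] (P : Measure Ω)
    [IsProbabilityMeasure P] (X : Ω → ℝ) : Prop :=
  ∀ (ν : Measure ℝ) [IsProbabilityMeasure ν], ν ≪ volume →
    TendstoInDistribution Fn atTop X (fun _ => ν) P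

/-- If the average exists, `avg` is its value. -/
theorem HasAvg.avg_eq {G : ℝ → ℂ} {l : ℂ} (h : HasAvg G l) : avg G = l :=
  Tendsto.limUnder_eq h

end Boole

end

noncomputable section

namespace Boole

open ProbabilityTheory Set
open scoped ENNReal NNReal

/-! By Lévy's continuity theorem, (a) reduces to `HasAvg.tendsto_integral_iterate`: if `|G| ≤ 1` has
average `l`, then `∫ G ∘ T^n dν → l` for every probability `ν ≪ m`; apply it to `G = e^{iθF}`.

The Boole map is the boundary value of `w ↦ w - 1/w` on the upper half-plane, so it carries the
Cauchy law at `w` to the Cauchy law at `w - 1/w` (`map_booleMap_cauchyAt`). Orbits there satisfy `im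
→ ∞` and `re / im → 0`, so in rescaled form the pushed laws approach centred Cauchy laws of growing
scale. These are mixtures of uniform laws on `[-a, a]`, whence convergence to the average
(`HasAvg.tendsto_integral_cauchyAt`). A general density is `L¹`-close to its convolution with a
narrow Cauchy kernel, a mixture of Cauchy laws, with an error uniform in `n`
(`tendsto_integral_smul_of_forall_cauchyAt`).

For (b), the averages are pointwise limits of characteristic functions, and continuity at `0` makes
the corresponding laws tight. -/

/-! ### Inverse branches and transfer operator of the Boole map. -/

/-- The inverse branch of the Boole map with values in `(0, ∞)`. -/
def posBranch (y : ℝ) : ℝ := (y + √(y ^ 2 + 4)) / 2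

theorem abs_lt_sqrt_sq_add_four (y : ℝ) : |y| < √(y ^ 2 + 4) := by
  rw [← Real.sqrt_sq_eq_abs]
  exact Real.sqrt_lt_sqrt (sq_nonneg y) (by linarith)

theorem posBranch_pos (y : ℝ) : 0 < posBranch y := by
  have := abs_lt_sqrt_sq_add_four y
  have := neg_abs_le y
  unfold posBranch
  linarith

theorem posBranch_sub_inv (y : ℝ) : posBranch y - 1 / posBranch y = y := by
  have h := (posBranch_pos y).ne'
  have hs : √(y ^ 2 + 4) ^ 2 = y ^ 2 + 4 := Real.sq_sqrt (by positivity)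
  have : posBranch y ^ 2 - 1 = y * posBranch y := by
    unfold posBranch
    linear_combination hs / 4
  field_simp
  linarith

theorem sqrt_sq_add_four (y : ℝ) : √(y ^ 2 + 4) = posBranch y + 1 / posBranch y := by
  have h := posBranch_sub_inv y
  have h2 : √(y ^ 2 + 4) = 2 * posBranch y - y := by unfold posBranch; ring
  linarith

theorem eq_posBranch {x y : ℝ} (hx : 0 < x) (h : x - 1 / x = y) : x = posBranch y := by
  have h1 : √(y ^ 2 + 4) = x + 1 / x := by
    rw [Real.sqrt_eq_iff_mul_self_eq (by positivity) (by positivity), ← h]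
    field_simp
    ring
  rw [posBranch, h1, ← h]
  ring

theorem posBranch_injective : Function.Injective posBranch := fun y z h => by
  rw [← posBranch_sub_inv y, ← posBranch_sub_inv z, h]

theorem image_posBranch : posBranch '' univ = Ioi 0 := by
  ext x
  constructor
  · rintro ⟨y, -, rfl⟩
    exact posBranch_pos y
  · intro hx
    exact ⟨x - 1 / x, mem_univ _, (eq_posBranch hx rfl).symm⟩

theorem hasDerivAt_posBranch (y : ℝ) :
    HasDerivAt posBranch (posBranch y ^ 2 / (1 + posBranch y ^ 2)) y := by
  have h0 : y ^ 2 + 4 ≠ 0 := by positivity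
  have h := (((hasDerivAt_id y).pow 2).add_const 4).sqrt h0
  have h' := ((hasDerivAt_id y).add h).div_const 2
  refine h'.congr_deriv ?_
  have hp := posBranch_pos y
  have hy := posBranch_sub_inv y
  have hs := sqrt_sq_add_four y
  simp only [Pi.pow_apply, id, hs, Nat.cast_ofNat, Nat.add_one_sub_one, pow_one, mul_one]
  generalize posBranch y = x at *
  rw [← hy]
  field_simp
  ring

/-- The inverse branch of the Boole map with values in `(-∞, 0)`. -/
def negBranch (y : ℝ) : ℝ := -1 / posBranch y

theorem negBranch_neg (y : ℝ) : negBranch y < 0 :=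
  div_neg_of_neg_of_pos (by norm_num) (posBranch_pos y)

theorem negBranch_sub_inv (y : ℝ) : negBranch y - 1 / negBranch y = y := by
  have h := (posBranch_pos y).ne'
  have hy := posBranch_sub_inv y
  unfold negBranch
  generalize posBranch y = x at *
  rw [← hy]
  field_simp
  ring

theorem image_negBranch : negBranch '' univ = Iio 0 := by
  ext x
  constructor
  · rintro ⟨y, -, rfl⟩
    exact negBranch_neg y
  · intro hx
    have hx' : x < 0 := hx
    -- The involution `x ↦ -1/x` leaves the Boole map invariant and swaps the two half-lines.
    have h : 0 < -1 / x := div_pos_of_neg_of_neg (by norm_num) hx'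
    refine ⟨x - 1 / x, mem_univ _, ?_⟩
    rw [negBranch, ← eq_posBranch h (by field_simp; ring)]
    field_simp

theorem hasDerivAt_negBranch (y : ℝ) :
    HasDerivAt negBranch (1 / (1 + posBranch y ^ 2)) y := by
  have hp := posBranch_pos y
  have h := ((hasDerivAt_const y (-1 : ℝ)).div (hasDerivAt_posBranch y) hp.ne')
  refine h.congr_deriv ?_
  field_simp
  ring

theorem negBranch_injective : Function.Injective negBranch := fun y z h => by
  rw [← negBranch_sub_inv y, ← negBranch_sub_inv z, h]

@[fun_prop]
theorem measurable_booleMap : Measurable booleMap := by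
  unfold booleMap
  fun_prop

theorem booleMap_posBranch (y : ℝ) : booleMap (posBranch y) = y := posBranch_sub_inv y

theorem booleMap_negBranch (y : ℝ) : booleMap (negBranch y) = y := negBranch_sub_inv y

@[fun_prop]
theorem measurable_posBranch : Measurable posBranch := by
  unfold posBranch
  fun_prop

@[fun_prop]
theorem measurable_negBranch : Measurable negBranch := by
  unfold negBranch
  fun_prop

/-- The transfer operator of the Boole map with respect to Lebesgue measure, in duality form. -/
theorem lintegral_comp_booleMap_mul {f p : ℝ → ℝ≥0∞} (hf : Measurable f) (hp : Measurable p) :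
    ∫⁻ x, f (booleMap x) * p x = ∫⁻ y, f y *
      (ENNReal.ofReal (posBranch y ^ 2 / (1 + posBranch y ^ 2)) * p (posBranch y) +
        ENNReal.ofReal (1 / (1 + posBranch y ^ 2)) * p (negBranch y)) := by
  have h1 := lintegral_image_eq_lintegral_abs_deriv_mul MeasurableSet.univ
    (fun y _ => (hasDerivAt_posBranch y).hasDerivWithinAt) posBranch_injective.injOn
    (fun x => f (booleMap x) * p x)
  have h2 := lintegral_image_eq_lintegral_abs_deriv_mul MeasurableSet.univ
    (fun y _ => (hasDerivAt_negBranch y).hasDerivWithinAt) negBranch_injective.injOn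
    (fun x => f (booleMap x) * p x)
  simp only [image_posBranch, image_negBranch, booleMap_posBranch, booleMap_negBranch,
    setLIntegral_univ] at h1 h2
  rw [← lintegral_add_compl _ (measurableSet_Ioi (a := (0 : ℝ))), compl_Ioi,
    setLIntegral_congr Iio_ae_eq_Iic.symm, h1, h2, ← lintegral_add_left (by fun_prop)]
  refine lintegral_congr fun y => ?_
  rw [abs_of_nonneg (by positivity), abs_of_nonneg (by positivity)]
  ring

/-! ### Cauchy laws and the action on the upper half-plane. -/

/-- The Cauchy distribution attached to a point of the upper half-plane, that is, the harmonic
measure of the upper half-plane seen from `w`. -/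
def cauchyAt (w : ℂ) : Measure ℝ := cauchyMeasure w.re w.im.toNNReal

instance (w : ℂ) : IsProbabilityMeasure (cauchyAt w) := by
  unfold cauchyAt
  infer_instance

theorem cauchyAt_eq_withDensity {w : ℂ} (hw : 0 < w.im) :
    cauchyAt w = volume.withDensity (cauchyPDF w.re w.im.toNNReal) :=
  cauchyMeasure_of_scale_ne_zero _ (by simpa using hw)

theorem cauchyAt_absolutelyContinuous {w : ℂ} (hw : 0 < w.im) : cauchyAt w ≪ volume := by
  rw [cauchyAt_eq_withDensity hw]
  exact withDensity_absolutelyContinuous _ _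

theorem absolutelyContinuous_cauchyAt {w : ℂ} (hw : 0 < w.im) : volume ≪ cauchyAt w := by
  rw [cauchyAt_eq_withDensity hw]
  refine withDensity_absolutelyContinuous' (by fun_prop) (ae_of_all _ fun x => ?_)
  simpa [cauchyPDF] using cauchyPDF_pos w.re (by simpa using hw) x

theorem sub_inv_re (w : ℂ) : (w - w⁻¹).re = w.re * (1 - (w.re ^ 2 + w.im ^ 2)⁻¹) := by
  rw [Complex.sub_re, Complex.inv_re, Complex.normSq_apply]
  ring

theorem sub_inv_im (w : ℂ) : (w - w⁻¹).im = w.im * (1 + (w.re ^ 2 + w.im ^ 2)⁻¹) := by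
  rw [Complex.sub_im, Complex.inv_im, Complex.normSq_apply]
  ring

theorem sub_inv_im_pos {w : ℂ} (hw : 0 < w.im) : 0 < (w - w⁻¹).im := by
  rw [sub_inv_im]
  positivity

/-- The preimages `x` and `-1/x` of `x - 1/x` are weighted by the reciprocal derivatives. With `w =
u + iv`, everything rests on the factorisation `(x - 1/x) - (w - 1/w) = (x - w)(1 + xw) / (xw)`,
whose squared modulus is `e2`. -/
theorem cauchy_transfer_identity {u v x : ℝ} (hv : 0 < v) (hx : 0 < x) :
    x ^ 2 / (1 + x ^ 2) * (v * ((x - u) ^ 2 + v ^ 2)⁻¹) +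
        1 / (1 + x ^ 2) * (v * ((-1 / x - u) ^ 2 + v ^ 2)⁻¹) =
      v * (1 + (u ^ 2 + v ^ 2)⁻¹) *
        ((x - 1 / x - u * (1 - (u ^ 2 + v ^ 2)⁻¹)) ^ 2 +
          (v * (1 + (u ^ 2 + v ^ 2)⁻¹)) ^ 2)⁻¹ := by
  have hN : 0 < u ^ 2 + v ^ 2 := by positivity
  have hA : 0 < (x - u) ^ 2 + v ^ 2 := by positivity
  have hB : 0 < (1 + u * x) ^ 2 + (v * x) ^ 2 := by positivity
  have e1 : (-1 / x - u) ^ 2 + v ^ 2 = ((1 + u * x) ^ 2 + (v * x) ^ 2) / x ^ 2 := by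
    field_simp
    ring
  have e2 : (x - 1 / x - u * (1 - (u ^ 2 + v ^ 2)⁻¹)) ^ 2 +
      (v * (1 + (u ^ 2 + v ^ 2)⁻¹)) ^ 2 =
      ((x - u) ^ 2 + v ^ 2) * ((1 + u * x) ^ 2 + (v * x) ^ 2) / (x ^ 2 * (u ^ 2 + v ^ 2)) := by
    field_simp
    ring
  rw [e1, e2]
  field_simp
  ring

/-- The Boole map sends Cauchy distributions to Cauchy distributions, and acts on their parameters
by the analytic extension of the Boole map to the upper half-plane. -/
theorem map_booleMap_cauchyAt {w : ℂ} (hw : 0 < w.im) :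
    (cauchyAt w).map booleMap = cauchyAt (w - w⁻¹) := by
  ext s hs
  rw [Measure.map_apply measurable_booleMap hs, cauchyAt_eq_withDensity hw,
    cauchyAt_eq_withDensity (sub_inv_im_pos hw), withDensity_apply _ hs,
    withDensity_apply _ (measurable_booleMap hs), ← lintegral_indicator hs,
    ← lintegral_indicator (measurable_booleMap hs)]
  have key := lintegral_comp_booleMap_mul (f := s.indicator 1)
    (p := cauchyPDF w.re w.im.toNNReal) (measurable_one.indicator hs) (by fun_prop)
  refine (lintegral_congr fun x => ?_).trans (key.trans (lintegral_congr fun y => ?_))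
  · by_cases h : booleMap x ∈ s <;> simp [h]
  · by_cases h : y ∈ s
    · have hp := posBranch_pos y
      have hid := cauchy_transfer_identity (u := w.re) hw hp
      simp only [h, indicator_of_mem, Pi.one_apply, one_mul, cauchyPDF, cauchyPDFReal,
        Real.coe_toNNReal _ hw.le, Real.coe_toNNReal _ (sub_inv_im_pos hw).le]
      rw [← ENNReal.ofReal_mul (by positivity), ← ENNReal.ofReal_mul (by positivity),
        ← ENNReal.ofReal_add (by positivity) (by positivity), sub_inv_im, sub_inv_re]
      congr 1
      rw [posBranch_sub_inv] at hid
      unfold negBranch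
      linear_combination (Real.pi)⁻¹ * hid
    · simp [h]

/-- The Cauchy law at `i` is equivalent to Lebesgue measure and its image is again a Cauchy law.
This makes composition with iterates meaningful for an `F` that is only a.e. measurable. -/
theorem quasiMeasurePreserving_booleMap :
    Measure.QuasiMeasurePreserving booleMap volume volume := by
  refine ⟨measurable_booleMap, ?_⟩
  have hI : 0 < Complex.I.im := by simp
  refine ((absolutelyContinuous_cauchyAt hI).map measurable_booleMap).trans ?_
  rw [map_booleMap_cauchyAt hI]
  exact cauchyAt_absolutelyContinuous (sub_inv_im_pos hI)

/-! ### Orbits in the upper half-plane. -/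

/-- The orbit of a complex number under `w ↦ w - 1 / w`. -/
def cOrbit (w : ℂ) (n : ℕ) : ℂ := (fun z => z - z⁻¹)^[n] w

theorem cOrbit_succ (w : ℂ) (n : ℕ) :
    cOrbit w (n + 1) = cOrbit w n - (cOrbit w n)⁻¹ :=
  Function.iterate_succ_apply' _ _ _

theorem cOrbit_im_pos {w : ℂ} (hw : 0 < w.im) (n : ℕ) : 0 < (cOrbit w n).im := by
  induction n with
  | zero => exact hw
  | succ n ih =>
    rw [cOrbit_succ]
    exact sub_inv_im_pos ih

theorem map_iterate_booleMap_cauchyAt {w : ℂ} (hw : 0 < w.im) (n : ℕ) :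
    (cauchyAt w).map booleMap^[n] = cauchyAt (cOrbit w n) := by
  induction n with
  | zero => exact Measure.map_id
  | succ n ih =>
    rw [Function.iterate_succ', ← Measure.map_map measurable_booleMap
      (measurable_booleMap.iterate n), ih, map_booleMap_cauchyAt (cOrbit_im_pos hw n), cOrbit_succ]

/-- The imaginary parts along an orbit in the upper half-plane increase. -/
theorem cOrbit_im_monotone {w : ℂ} (hw : 0 < w.im) : Monotone fun n => (cOrbit w n).im := by
  refine monotone_nat_of_le_succ fun n => ?_
  have h := cOrbit_im_pos hw n
  rw [cOrbit_succ, sub_inv_im, mul_add, mul_one]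
  exact le_add_of_nonneg_right (by positivity)

theorem abs_cOrbit_re_succ_le {w : ℂ} (n : ℕ)
    (h : 1 ≤ (cOrbit w n).re ^ 2 + (cOrbit w n).im ^ 2) :
    |(cOrbit w (n + 1)).re| ≤ |(cOrbit w n).re| := by
  rw [cOrbit_succ, sub_inv_re, abs_mul]
  have h1 := inv_le_one_of_one_le₀ h
  have h2 : 0 ≤ ((cOrbit w n).re ^ 2 + (cOrbit w n).im ^ 2)⁻¹ := by positivity
  refine mul_le_of_le_one_right (abs_nonneg _) ?_
  rw [abs_le]
  constructor <;> linarith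

theorem exists_abs_cOrbit_re_le {w : ℂ}
    (h : ∀ᶠ n in atTop, 1 ≤ (cOrbit w n).re ^ 2 + (cOrbit w n).im ^ 2) :
    ∃ C, ∀ᶠ n in atTop, |(cOrbit w n).re| ≤ C := by
  obtain ⟨N, hN⟩ := eventually_atTop.1 h
  refine ⟨|(cOrbit w N).re|, eventually_atTop.2 ⟨N, fun n hn => ?_⟩⟩
  induction n, hn using Nat.le_induction with
  | base => exact le_rfl
  | succ n hn ih => exact (abs_cOrbit_re_succ_le n (hN n hn)).trans ih

/-- If the increasing imaginary parts had a finite limit, their successive ratios `1 + 1/|w_n|²`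
would tend to `1`, forcing `|w_n| → ∞`. But once `|w_n| ≥ 1` the real parts stop growing in absolute
value, so the orbit would be bounded. -/
theorem tendsto_cOrbit_im {w : ℂ} (hw : 0 < w.im) :
    Tendsto (fun n => (cOrbit w n).im) atTop atTop := by
  refine (tendsto_atTop_of_monotone (cOrbit_im_monotone hw)).resolve_right ?_
  rintro ⟨L, hL⟩
  have hLpos : 0 < L := hw.trans_le ((cOrbit_im_monotone hw).ge_of_tendsto hL 0)
  have hsucc : Tendsto (fun n => (cOrbit w (n + 1)).im) atTop (𝓝 L) :=
    hL.comp (tendsto_add_atTop_nat 1)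
  have hquot : Tendsto (fun n => ((cOrbit w n).re ^ 2 + (cOrbit w n).im ^ 2)⁻¹) atTop (𝓝 0) := by
    have h := (hsucc.div hL hLpos.ne').sub_const 1
    rw [div_self hLpos.ne', sub_self] at h
    refine h.congr fun n => ?_
    have hn := cOrbit_im_pos hw n
    simp only [Pi.div_apply]
    rw [cOrbit_succ, sub_inv_im, mul_div_cancel_left₀ _ hn.ne', add_sub_cancel_left]
  have hnorm : Tendsto (fun n => (cOrbit w n).re ^ 2 + (cOrbit w n).im ^ 2) atTop atTop := by
    refine ((tendsto_inv_nhdsGT_zero (𝕜 := ℝ)).comp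
      (tendsto_nhdsWithin_iff.2 ⟨hquot, .of_forall fun n => ?_⟩)).congr fun n => inv_inv _
    have hn := cOrbit_im_pos hw n
    have hpos : 0 < ((cOrbit w n).re ^ 2 + (cOrbit w n).im ^ 2)⁻¹ := by positivity
    exact hpos
  obtain ⟨C, hC⟩ := exists_abs_cOrbit_re_le (hnorm.eventually_ge_atTop 1)
  obtain ⟨n, h1, h2⟩ := (hC.and (hnorm.eventually_gt_atTop (C ^ 2 + L ^ 2))).exists
  have h3 : (cOrbit w n).im ≤ L := (cOrbit_im_monotone hw).ge_of_tendsto hL n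
  have h4 := sq_le_sq' (neg_le_of_abs_le h1) (le_of_abs_le h1)
  have h5 := pow_le_pow_left₀ (cOrbit_im_pos hw n).le h3 2
  linarith

/-- Orbits in the upper half-plane go to infinity in the vertical direction. -/
theorem tendsto_cOrbit_re_div_im {w : ℂ} (hw : 0 < w.im) :
    Tendsto (fun n => (cOrbit w n).re / (cOrbit w n).im) atTop (𝓝 0) := by
  have him := tendsto_cOrbit_im hw
  obtain ⟨C, hC⟩ := exists_abs_cOrbit_re_le (w := w) <| by
    filter_upwards [him.eventually_ge_atTop 1] with n hn
    nlinarith [sq_nonneg (cOrbit w n).re]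
  refine squeeze_zero_norm' ?_ (tendsto_const_nhds.div_atTop him : Tendsto (fun n =>
    C / (cOrbit w n).im) atTop (𝓝 0))
  filter_upwards [hC] with n hn
  have h := cOrbit_im_pos hw n
  rw [norm_div, Real.norm_eq_abs, Real.norm_eq_abs, abs_of_pos h]
  gcongr

/-! ### Cauchy integrals at large scale and infinite-volume averages. -/

/-- The density of the standard Cauchy distribution. -/
def cauchyKernel (s : ℝ) : ℝ := Real.pi⁻¹ * (1 + s ^ 2)⁻¹

theorem cauchyKernel_nonneg (s : ℝ) : 0 ≤ cauchyKernel s := by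
  have := Real.pi_pos
  unfold cauchyKernel
  positivity

@[fun_prop]
theorem continuous_cauchyKernel : Continuous cauchyKernel := by
  unfold cauchyKernel
  have h : ∀ s : ℝ, 1 + s ^ 2 ≠ 0 := fun s => by positivity
  fun_prop (disch := exact h _)

theorem integrable_cauchyKernel : Integrable cauchyKernel :=
  integrable_inv_one_add_sq.const_mul _

theorem integral_cauchyKernel : ∫ s, cauchyKernel s = 1 := by
  simp only [cauchyKernel, integral_const_mul, integral_univ_inv_one_add_sq]
  exact inv_mul_cancel₀ Real.pi_ne_zero

theorem integral_cauchyAt {w : ℂ} (hw : 0 < w.im) (G : ℝ → ℂ) :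
    ∫ x, G x ∂cauchyAt w = ∫ s, cauchyKernel s • G (w.re + w.im * s) := by
  rw [cauchyAt_eq_withDensity hw, integral_withDensity_eq_integral_toReal_smul (by fun_prop)
    (ae_of_all _ fun x => by simp [cauchyPDF])]
  have h := Measure.integral_comp_mul_left
    (fun x => (cauchyPDFReal w.re w.im.toNNReal (w.re + x)) • G (w.re + x)) w.im
  rw [integral_add_left_eq_self (fun x => (cauchyPDFReal w.re w.im.toNNReal x) • G x) w.re,
    abs_of_pos (inv_pos.2 hw)] at h
  have h0 : ∀ x, (cauchyPDF w.re w.im.toNNReal x).toReal = cauchyPDFReal w.re w.im.toNNReal x :=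
    fun x => ENNReal.toReal_ofReal (cauchyPDF_pos _ (by simpa using hw) x).le
  simp only [h0]
  rw [← inv_smul_eq_iff₀ (inv_ne_zero hw.ne')] at h
  rw [← h, inv_inv, ← integral_smul]
  refine integral_congr_ae (ae_of_all _ fun s => ?_)
  simp only [smul_smul, cauchyPDFReal_def, Real.coe_toNNReal _ hw.le, cauchyKernel]
  congr 1
  have : 0 < 1 + s ^ 2 := by positivity
  have e : (w.re + w.im * s - w.re) ^ 2 + w.im ^ 2 = w.im ^ 2 * (1 + s ^ 2) := by ring
  rw [e]
  field_simp

/-- Translations act continuously on integrable functions. -/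
theorem continuous_integral_norm_sub_translate {g : ℝ → ℝ} (hg : Integrable g) :
    Continuous fun h : ℝ => ∫ x, ‖g (x + h) - g x‖ := by
  let τ : ℝ → C(ℝ, ℝ) := fun h => ⟨fun x => x + h, by fun_prop⟩
  have hτ : Continuous τ := (ContinuousMap.curry
    ⟨fun p : ℝ × ℝ => p.2 + p.1, by fun_prop⟩).continuous
  have hm : ∀ h, MeasurePreserving (τ h) volume volume := fun h =>
    measurePreserving_add_right volume h
  have hc : Continuous fun h => Lp.compMeasurePreserving (τ h) (hm h) (hg.toL1 g) :=
    continuous_const.compMeasurePreservingLp hτ hm ENNReal.one_ne_top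
  refine (hc.sub (continuous_const (y := hg.toL1 g))).norm.congr fun h => ?_
  rw [L1.norm_eq_integral_norm]
  refine integral_congr_ae ?_
  have h1 := (hm h).quasiMeasurePreserving.ae_eq_comp hg.coeFn_toL1
  filter_upwards [Lp.coeFn_sub (Lp.compMeasurePreserving (τ h) (hm h) (hg.toL1 g)) (hg.toL1 g),
    Lp.coeFn_compMeasurePreserving (hg.toL1 g) (hm h), h1, hg.coeFn_toL1] with x e1 e2 e3 e4
  refine (congrArg _ e1).trans ?_
  rw [Pi.sub_apply, e2, e3, e4]
  rfl

theorem integral_norm_sub_translate_le {g : ℝ → ℝ} (hg : Integrable g) (h : ℝ) :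
    ∫ x, ‖g (x + h) - g x‖ ≤ 2 * ∫ x, ‖g x‖ := by
  calc ∫ x, ‖g (x + h) - g x‖ ≤ ∫ x, (‖g (x + h)‖ + ‖g x‖) :=
        integral_mono ((hg.comp_add_right h).sub hg).norm
          ((hg.comp_add_right h).norm.add hg.norm) fun x => norm_sub_le _ _
    _ = 2 * ∫ x, ‖g x‖ := by
        rw [integral_add (hg.comp_add_right h).norm hg.norm,
          integral_add_right_eq_self (fun x => ‖g x‖) h, two_mul]

/-- Minus the derivative of the standard Cauchy density. -/
def cauchyLayer (a : ℝ) : ℝ := Real.pi⁻¹ * (2 * a / (1 + a ^ 2) ^ 2)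

theorem cauchyLayer_nonneg {a : ℝ} (ha : 0 ≤ a) : 0 ≤ cauchyLayer a := by
  have := Real.pi_pos
  unfold cauchyLayer
  positivity

@[fun_prop]
theorem continuous_cauchyLayer : Continuous cauchyLayer := by
  unfold cauchyLayer
  have h : ∀ s : ℝ, (1 + s ^ 2) ^ 2 ≠ 0 := fun s => by positivity
  fun_prop (disch := exact h _)

theorem hasDerivAt_neg_cauchyKernel (a : ℝ) :
    HasDerivAt (fun x => -cauchyKernel x) (cauchyLayer a) a := by
  have h0 : 1 + a ^ 2 ≠ 0 := by positivity
  have h := ((((hasDerivAt_id a).pow 2).const_add 1).inv h0).const_mul Real.pi⁻¹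
  refine h.neg.congr_deriv ?_
  simp only [cauchyLayer, Pi.pow_apply, id, Nat.cast_ofNat, Nat.add_one_sub_one, pow_one, mul_one]
  ring

theorem tendsto_neg_cauchyKernel_atTop :
    Tendsto (fun x => -cauchyKernel x) atTop (𝓝 0) := by
  have h : Tendsto (fun x : ℝ => 1 + x ^ 2) atTop atTop :=
    tendsto_atTop_add_const_left _ _ (tendsto_pow_atTop two_ne_zero)
  simpa [cauchyKernel] using ((tendsto_inv_atTop_zero.comp h).const_mul Real.pi⁻¹).neg

theorem integrableOn_cauchyLayer (s : ℝ) : IntegrableOn cauchyLayer (Ioi |s|) :=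
  integrableOn_Ioi_deriv_of_nonneg' (fun x _ => hasDerivAt_neg_cauchyKernel x)
    (fun _ hx => cauchyLayer_nonneg ((abs_nonneg s).trans (le_of_lt hx)))
    tendsto_neg_cauchyKernel_atTop

theorem integral_cauchyLayer (s : ℝ) : ∫ a in Ioi |s|, cauchyLayer a = cauchyKernel s := by
  rw [integral_Ioi_of_hasDerivAt_of_nonneg' (fun x _ => hasDerivAt_neg_cauchyKernel x)
    (fun _ hx => cauchyLayer_nonneg ((abs_nonneg s).trans (le_of_lt hx)))
    tendsto_neg_cauchyKernel_atTop]
  simp [cauchyKernel]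

/-- The Cauchy distribution is a mixture of the uniform distributions on symmetric intervals. -/
theorem integral_cauchyKernel_smul {G : ℝ → ℂ} (hG : Measurable G) (hb : ∀ x, ‖G x‖ ≤ 1) :
    ∫ s, cauchyKernel s • G s =
      ∫ a in Ioi (0 : ℝ), cauchyLayer a • ∫ s in (-a)..a, G s := by
  -- Layer-cake argument: `cauchyKernel s` is the integral of `cauchyLayer` over `a > |s|`; Fubini
  -- then gives the mixture.
  let Φ : ℝ → ℝ → ℂ := fun s a => (Ioi |s|).indicator (fun a => cauchyLayer a • G s) a
  have hS : MeasurableSet {p : ℝ × ℝ | |p.1| < p.2} :=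
    measurableSet_lt (by fun_prop) (by fun_prop)
  have hΦm : AEStronglyMeasurable (Function.uncurry Φ) (volume.prod volume) := by
    have h : Measurable ({p : ℝ × ℝ | |p.1| < p.2}.indicator
        fun p : ℝ × ℝ => cauchyLayer p.2 • G p.1) := Measurable.indicator (by fun_prop) hS
    exact h.aestronglyMeasurable
  have hin : ∀ s, ∫ a, Φ s a = cauchyKernel s • G s := fun s => by
    simp only [Φ]
    rw [integral_indicator measurableSet_Ioi, integral_smul_const, integral_cauchyLayer]
  have hΦ : Integrable (Function.uncurry Φ) (volume.prod volume) := by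
    refine (integrable_prod_iff hΦm).2 ⟨ae_of_all _ fun s => ?_, ?_⟩
    · exact (integrable_indicator_iff measurableSet_Ioi).2
        (Integrable.smul_const (integrableOn_cauchyLayer s) (G s))
    · have e : ∀ s, ∫ a, ‖Φ s a‖ = cauchyKernel s * ‖G s‖ := fun s => by
        simp only [Φ, norm_indicator_eq_indicator_norm, norm_smul]
        rw [integral_indicator measurableSet_Ioi, integral_mul_const, ← integral_cauchyLayer]
        congr 1
        refine setIntegral_congr_fun measurableSet_Ioi fun a ha => ?_
        exact Real.norm_of_nonneg (cauchyLayer_nonneg ((abs_nonneg s).trans (le_of_lt ha)))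
      simp only [Function.uncurry_apply_pair, e]
      refine integrable_cauchyKernel.mul_bdd (c := 1) (by fun_prop) (ae_of_all _ fun s => ?_)
      simpa using hb s
  calc ∫ s, cauchyKernel s • G s = ∫ s, ∫ a, Φ s a := by simp only [hin]
    _ = ∫ a, ∫ s, Φ s a := integral_integral_swap hΦ
    _ = ∫ a, (Ioi (0 : ℝ)).indicator (fun a => cauchyLayer a • ∫ s in (-a)..a, G s) a := by
        refine integral_congr_ae (ae_of_all _ fun a => ?_)
        have e : ∀ s, Φ s a = (Ioo (-a) a).indicator (fun s => cauchyLayer a • G s) s := fun s => by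
          simp only [Φ, indicator_apply, mem_Ioi, mem_Ioo, abs_lt]
        simp only [e]
        rw [integral_indicator measurableSet_Ioo, integral_smul]
        by_cases ha : 0 < a
        · rw [indicator_of_mem (mem_Ioi.2 ha), intervalIntegral.integral_of_le (by linarith),
            integral_Ioc_eq_integral_Ioo]
        · rw [indicator_of_notMem (by simpa using ha), Ioo_eq_empty (by linarith)]
          simp
    _ = _ := integral_indicator measurableSet_Ioi

theorem HasAvg.tendsto_integral_cauchyKernel_smul {G : ℝ → ℂ} {l : ℂ} (h : HasAvg G l)
    (hG : Measurable G) (hb : ∀ x, ‖G x‖ ≤ 1) :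
    Tendsto (fun y : ℝ => ∫ s, cauchyKernel s • G (y * s)) atTop (𝓝 l) := by
  -- The mixing weights have total mass one: take `G = 1` in the mixture formula.
  have hmass : ∫ a in Ioi (0 : ℝ), cauchyLayer a * (2 * a) = 1 := by
    have e := integral_cauchyKernel_smul (G := fun _ => 1) measurable_const (by simp)
    rw [integral_smul_const, integral_cauchyKernel] at e
    have e2 : ∀ a : ℝ, cauchyLayer a • ∫ _ in (-a)..a, (1 : ℂ) =
        ((cauchyLayer a * (2 * a) : ℝ) : ℂ) := fun a => by
      rw [intervalIntegral.integral_const]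
      simp only [Complex.real_smul]
      push_cast
      ring
    simp only [e2, one_smul] at e
    rw [integral_complex_ofReal] at e
    exact_mod_cast e.symm
  have hint : IntegrableOn (fun a => cauchyLayer a * (2 * a)) (Ioi (0 : ℝ)) :=
    -- A non-integrable function would have integral `0` by convention.
    Integrable.of_integral_ne_zero (by rw [hmass]; exact one_ne_zero)
  have hl : l = ∫ a in Ioi (0 : ℝ), (cauchyLayer a * (2 * a)) • l := by
    rw [integral_smul_const, hmass, one_smul]
  rw [hl]
  have key : (fun y : ℝ => ∫ s, cauchyKernel s • G (y * s)) =ᶠ[atTop] fun y =>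
      ∫ a in Ioi (0 : ℝ), (cauchyLayer a * (2 * a)) •
        (((1 / (2 * (y * a)) : ℝ) : ℂ) * ∫ x in (-(y * a))..(y * a), G x) := by
    filter_upwards [eventually_gt_atTop 0] with y hy
    rw [integral_cauchyKernel_smul (by fun_prop) fun x => hb _]
    refine setIntegral_congr_fun measurableSet_Ioi fun a ha => ?_
    have ha' : 0 < a := ha
    rw [intervalIntegral.integral_comp_mul_left G hy.ne', mul_neg, ← Complex.real_smul, smul_smul,
      smul_smul]
    congr 1
    field_simp
  refine Tendsto.congr' key.symm ?_
  refine tendsto_integral_filter_of_dominated_convergence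
    (fun a => cauchyLayer a * (2 * a)) ?_ ?_ hint ?_
  · refine .of_forall fun y => Measurable.aestronglyMeasurable ?_
    have hp : Measurable fun b : ℝ => ∫ x in (-b)..b, G x := by
      have hc : Continuous fun b : ℝ => ∫ x in (0 : ℝ)..b, G x :=
        intervalIntegral.continuous_primitive (fun a b =>
          (intervalIntegrable_const (c := (1 : ℝ))).mono_fun' hG.aestronglyMeasurable
            (ae_of_all _ hb)) 0
      have e : ∀ b : ℝ, ∫ x in (-b)..b, G x =
          (∫ x in (0 : ℝ)..b, G x) - ∫ x in (0 : ℝ)..(-b), G x := fun b => by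
        have hi : ∀ a b : ℝ, IntervalIntegrable G volume a b := fun a b =>
          (intervalIntegrable_const (c := (1 : ℝ))).mono_fun' hG.aestronglyMeasurable
            (ae_of_all _ hb)
        rw [intervalIntegral.integral_interval_sub_left (hi _ _) (hi _ _)]
      simp only [e]
      exact (hc.sub (hc.comp continuous_neg)).measurable
    have hp2 : Measurable fun a : ℝ => ∫ x in (-(y * a))..(y * a), G x :=
      hp.comp (measurable_const_mul y)
    fun_prop
  · filter_upwards [eventually_gt_atTop 0] with y hy
    refine (ae_restrict_iff' measurableSet_Ioi).2 (ae_of_all _ fun a (ha : 0 < a) => ?_)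
    have hya : 0 < y * a := mul_pos hy ha
    have h1 : ‖∫ x in (-(y * a))..(y * a), G x‖ ≤ 1 * |y * a - -(y * a)| :=
      intervalIntegral.norm_integral_le_of_norm_le_const fun x _ => hb x
    rw [norm_smul, norm_mul (_ : ℂ), Complex.norm_real,
      Real.norm_of_nonneg (mul_nonneg (cauchyLayer_nonneg ha.le) (by positivity)),
      Real.norm_of_nonneg (by positivity)]
    refine mul_le_of_le_one_right (mul_nonneg (cauchyLayer_nonneg ha.le) (by positivity)) ?_
    rw [one_div, inv_mul_le_one₀ (by positivity)]
    refine h1.trans (le_of_eq ?_)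
    rw [abs_of_pos (by linarith)]
    ring
  · refine (ae_restrict_iff' measurableSet_Ioi).2 (ae_of_all _ fun a (ha : 0 < a) => ?_)
    exact (h.comp (tendsto_id.atTop_mul_const ha)).const_smul _

/-- Cauchy distributions whose parameters tend to infinity vertically compute averages. -/
theorem HasAvg.tendsto_integral_cauchyAt {G : ℝ → ℂ} {l : ℂ} (h : HasAvg G l)
    (hG : Measurable G) (hb : ∀ x, ‖G x‖ ≤ 1) {w : ℕ → ℂ}
    (him : Tendsto (fun n => (w n).im) atTop atTop)
    (hre : Tendsto (fun n => (w n).re / (w n).im) atTop (𝓝 0)) :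
    Tendsto (fun n => ∫ x, G x ∂cauchyAt (w n)) atTop (𝓝 l) := by
  have h1 := (h.tendsto_integral_cauchyKernel_smul hG hb).comp him
  -- In units of the scale `im`, the off-centre law is the standard kernel translated by `re / im`,
  -- so the `L¹` modulus of continuity controls the discrepancy.
  have hω : Tendsto (fun n => ∫ x, ‖cauchyKernel (x + -((w n).re / (w n).im)) - cauchyKernel x‖)
      atTop (𝓝 0) := by
    have h := ((continuous_integral_norm_sub_translate integrable_cauchyKernel).tendsto 0).comp
      (neg_zero (G := ℝ) ▸ hre.neg)
    simpa [Function.comp_def] using h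
  have hdiff : Tendsto (fun n => (∫ x, G x ∂cauchyAt (w n)) -
      ∫ s, cauchyKernel s • G ((w n).im * s)) atTop (𝓝 0) := by
    refine squeeze_zero_norm' ?_ hω
    filter_upwards [him.eventually_gt_atTop 0] with n hn
    set r := (w n).re / (w n).im with hr
    have hi : ∀ k : ℝ → ℝ, Integrable k → Integrable fun s => k s • G ((w n).im * s) :=
      fun k hk => hk.smul_bdd 1 (hG.comp (measurable_const_mul _)).aestronglyMeasurable
      (ae_of_all _ fun s => hb _)
    have e : ∫ x, G x ∂cauchyAt (w n) = ∫ s, cauchyKernel (s + -r) • G ((w n).im * s) := by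
      rw [integral_cauchyAt hn, 
        ← integral_add_right_eq_self (fun s => cauchyKernel (s + -r) • G ((w n).im * s)) r]
      refine integral_congr_ae (ae_of_all _ fun s => ?_)
      simp only [add_neg_cancel_right]
      congr 2
      rw [hr]
      field_simp
      ring
    rw [e, ← integral_sub (hi _ (integrable_cauchyKernel.comp_add_right _))
      (hi _ integrable_cauchyKernel)]
    refine norm_integral_le_of_norm_le
      ((integrable_cauchyKernel.comp_add_right _).sub integrable_cauchyKernel).norm
      (ae_of_all _ fun s => ?_)
    rw [← sub_smul, norm_smul]
    exact mul_le_of_le_one_right (norm_nonneg _) (hb _)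
  simpa using hdiff.add h1

/-! ### From Cauchy laws to all absolutely continuous laws. -/

/-- The `L¹` modulus of continuity of `g`, averaged against a Cauchy distribution of scale `ε`. -/
def cauchyModulus (g : ℝ → ℝ) (ε : ℝ) : ℝ :=
  ∫ s, cauchyKernel s * ∫ x, ‖g (x + -(ε * s)) - g x‖

theorem integrable_cauchyKernel_mul_modulus {g : ℝ → ℝ} (hg : Integrable g) (ε : ℝ) :
    Integrable fun s => cauchyKernel s * ∫ x, ‖g (x + -(ε * s)) - g x‖ := by
  refine integrable_cauchyKernel.mul_bdd (c := 2 * ∫ x, ‖g x‖) ?_ (ae_of_all _ fun s => ?_)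
  · exact ((continuous_integral_norm_sub_translate hg).comp
      (by fun_prop : Continuous fun s : ℝ => -(ε * s))).aestronglyMeasurable
  · rw [Real.norm_of_nonneg (integral_nonneg fun _ => norm_nonneg _)]
    exact integral_norm_sub_translate_le hg _

theorem tendsto_cauchyModulus {g : ℝ → ℝ} (hg : Integrable g) :
    Tendsto (cauchyModulus g) (𝓝[>] 0) (𝓝 0) := by
  have hc := continuous_integral_norm_sub_translate hg
  have h0 : (0 : ℝ) = ∫ s, cauchyKernel s * 0 := by simp
  conv => enter [3, 1]; rw [h0]
  refine tendsto_integral_filter_of_dominated_convergence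
    (fun s => cauchyKernel s * (2 * ∫ x, ‖g x‖)) ?_ ?_ (integrable_cauchyKernel.mul_const _) ?_
  · exact .of_forall fun ε => (integrable_cauchyKernel_mul_modulus hg ε).aestronglyMeasurable
  · refine .of_forall fun ε => ae_of_all _ fun s => ?_
    rw [Real.norm_of_nonneg (mul_nonneg (cauchyKernel_nonneg s)
      (integral_nonneg fun _ => norm_nonneg _))]
    exact mul_le_mul_of_nonneg_left (integral_norm_sub_translate_le hg _) (cauchyKernel_nonneg s)
  · refine ae_of_all _ fun s => ?_
    have hs : Continuous fun ε : ℝ => ∫ x, ‖g (x + -(ε * s)) - g x‖ :=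
      hc.comp (by fun_prop : Continuous fun ε : ℝ => -(ε * s))
    have h := (hs.tendsto 0).mono_left (nhdsWithin_le_nhds (s := Ioi 0))
    simpa using h.const_mul (cauchyKernel s)

/-- Fubini and the substitution `x = t + εs` move the smoothing from `H` to `g`. -/
theorem integral_smul_integral_cauchyAt {g : ℝ → ℝ} (hg : Integrable g) {H : ℝ → ℂ}
    (hm : Measurable H) (hb : ∀ x, ‖H x‖ ≤ 1) {ε : ℝ} (hε : 0 < ε) :
    ∫ t, g t • ∫ x, H x ∂cauchyAt ⟨t, ε⟩ =
      ∫ s, cauchyKernel s • ∫ x, g (x + -(ε * s)) • H x := by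
  have hint : Integrable (Function.uncurry fun t s => (g t * cauchyKernel s) • H (t + ε * s))
      (volume.prod volume) := by
    refine (hg.mul_prod integrable_cauchyKernel).smul_bdd 1 ?_ (ae_of_all _ fun p => hb _)
    exact (hm.comp (by fun_prop : Measurable fun p : ℝ × ℝ => p.1 + ε * p.2)).aestronglyMeasurable
  calc ∫ t, g t • ∫ x, H x ∂cauchyAt ⟨t, ε⟩
      = ∫ t, ∫ s, (g t * cauchyKernel s) • H (t + ε * s) := by
        refine integral_congr_ae (ae_of_all _ fun t => ?_)
        simp only [integral_cauchyAt (w := ⟨t, ε⟩) hε, mul_smul, integral_smul]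
    _ = ∫ s, ∫ t, (g t * cauchyKernel s) • H (t + ε * s) := integral_integral_swap hint
    _ = _ := by
        refine integral_congr_ae (ae_of_all _ fun s => ?_)
        simp only
        rw [← integral_add_right_eq_self (fun x => g (x + -(ε * s)) • H x) (ε * s),
          ← integral_smul]
        simp only [add_neg_cancel_right, smul_smul, mul_comm (cauchyKernel s)]

/-- The bound does not depend on `H`, hence serves a whole sequence `H n` at once. -/
theorem norm_integral_smul_sub_le {g : ℝ → ℝ} (hg : Integrable g) {H : ℝ → ℂ}
    (hm : Measurable H) (hb : ∀ x, ‖H x‖ ≤ 1) {ε : ℝ} (hε : 0 < ε) :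
    ‖(∫ x, g x • H x) - ∫ t, g t • ∫ x, H x ∂cauchyAt ⟨t, ε⟩‖ ≤ cauchyModulus g ε := by
  have hi : ∀ k : ℝ → ℝ, Integrable k → Integrable fun x => k x • H x :=
    fun k hk => hk.smul_bdd 1 hm.aestronglyMeasurable (ae_of_all _ hb)
  have hd : ∀ s, ‖(∫ x, g (x + -(ε * s)) • H x) - ∫ x, g x • H x‖ ≤
      ∫ x, ‖g (x + -(ε * s)) - g x‖ := fun s => by
    rw [← integral_sub (hi _ (hg.comp_add_right _)) (hi _ hg)]
    refine norm_integral_le_of_norm_le ((hg.comp_add_right _).sub hg).norm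
      (ae_of_all _ fun x => ?_)
    rw [← sub_smul, norm_smul]
    exact mul_le_of_le_one_right (norm_nonneg _) (hb _)
  have hA : ∫ x, g x • H x = ∫ s, cauchyKernel s • ∫ x, g x • H x := by
    rw [integral_smul_const, integral_cauchyKernel, one_smul]
  have hint : Integrable fun s => cauchyKernel s • ∫ x, g (x + -(ε * s)) • H x := by
    have hp : Integrable (Function.uncurry fun s t =>
        (cauchyKernel s * g t) • H (t + ε * s)) (volume.prod volume) := by
      refine (integrable_cauchyKernel.mul_prod hg).smul_bdd 1 ?_ (ae_of_all _ fun p => hb _)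
      exact (hm.comp
        (by fun_prop : Measurable fun p : ℝ × ℝ => p.2 + ε * p.1)).aestronglyMeasurable
    refine hp.integral_prod_left.congr (ae_of_all _ fun s => ?_)
    simp only [Function.uncurry_apply_pair, mul_smul, integral_smul]
    rw [← integral_add_right_eq_self (fun x => g (x + -(ε * s)) • H x) (ε * s)]
    simp only [add_neg_cancel_right]
  rw [norm_sub_rev, integral_smul_integral_cauchyAt hg hm hb hε, hA,
    ← integral_sub hint (integrable_cauchyKernel.smul_const _)]
  refine norm_integral_le_of_norm_le (integrable_cauchyKernel_mul_modulus hg ε)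
    (ae_of_all _ fun s => ?_)
  rw [← smul_sub, norm_smul, Real.norm_of_nonneg (cauchyKernel_nonneg s)]
  exact mul_le_mul_of_nonneg_left (hd s) (cauchyKernel_nonneg s)

theorem tendsto_integral_smul_integral_cauchyAt {g : ℝ → ℝ} (hg : Integrable g)
    {H : ℕ → ℝ → ℂ} (hm : ∀ n, Measurable (H n)) (hb : ∀ n x, ‖H n x‖ ≤ 1) {l : ℂ} {ε : ℝ}
    (hε : 0 < ε)
    (h : ∀ w : ℂ, 0 < w.im → Tendsto (fun n => ∫ x, H n x ∂cauchyAt w) atTop (𝓝 l)) :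
    Tendsto (fun n => ∫ t, g t • ∫ x, H n x ∂cauchyAt ⟨t, ε⟩) atTop (𝓝 ((∫ t, g t) • l)) := by
  rw [← integral_smul_const]
  refine tendsto_integral_of_dominated_convergence (fun t => ‖g t‖) (fun n => ?_) hg.norm
    (fun n => ae_of_all _ fun t => ?_) (ae_of_all _ fun t => (h ⟨t, ε⟩ hε).const_smul _)
  · refine hg.aestronglyMeasurable.smul ?_
    have hs : StronglyMeasurable fun p : ℝ × ℝ => cauchyKernel p.2 • H n (p.1 + ε * p.2) := by
      have := hm n
      exact (by fun_prop : Measurable _).stronglyMeasurable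
    refine (hs.integral_prod_right' (ν := volume)).aestronglyMeasurable.congr (ae_of_all _ fun t => ?_)
    exact (integral_cauchyAt (w := ⟨t, ε⟩) hε (H n)).symm
  · rw [norm_smul]
    refine mul_le_of_le_one_right (norm_nonneg _) ?_
    simpa using norm_integral_le_of_norm_le_const (μ := cauchyAt ⟨t, ε⟩) (ae_of_all _ (hb n))

/-- To compute the limits of the integrals of a bounded sequence of functions against all
absolutely continuous laws, it is enough to consider Cauchy distributions. -/
theorem tendsto_integral_smul_of_forall_cauchyAt {g : ℝ → ℝ} (hg : Integrable g)
    {H : ℕ → ℝ → ℂ} (hm : ∀ n, Measurable (H n)) (hb : ∀ n x, ‖H n x‖ ≤ 1) {l : ℂ}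
    (h : ∀ w : ℂ, 0 < w.im → Tendsto (fun n => ∫ x, H n x ∂cauchyAt w) atTop (𝓝 l)) :
    Tendsto (fun n => ∫ x, g x • H n x) atTop (𝓝 ((∫ x, g x) • l)) := by
  rw [Metric.tendsto_atTop]
  intro δ hδ
  -- The smoothing scale is fixed before `N`, which is possible because the smoothing error is
  -- uniform in `n`.
  obtain ⟨ε, hε1, hε⟩ := (((tendsto_cauchyModulus hg).eventually_lt_const (half_pos hδ)).and
    self_mem_nhdsWithin).exists
  obtain ⟨N, hN⟩ := Metric.tendsto_atTop.1
    (tendsto_integral_smul_integral_cauchyAt hg hm hb hε h) (δ / 2) (half_pos hδ)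
  refine ⟨N, fun n hn => (dist_triangle _
    (∫ t, g t • ∫ x, H n x ∂cauchyAt ⟨t, ε⟩) _).trans_lt ?_⟩
  have h1 := norm_integral_smul_sub_le hg (hm n) (hb n) hε
  rw [← dist_eq_norm] at h1
  linarith [hN n hn]

/-- Global-local mixing of the Boole map. -/
theorem HasAvg.tendsto_integral_iterate {G : ℝ → ℂ} {l : ℂ} (h : HasAvg G l)
    (hG : Measurable G) (hb : ∀ x, ‖G x‖ ≤ 1) (ν : Measure ℝ) [IsProbabilityMeasure ν]
    (hν : ν ≪ volume) :
    Tendsto (fun n => ∫ x, G (booleMap^[n] x) ∂ν) atTop (𝓝 l) := by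
  have hT := fun n => measurable_booleMap.iterate n
  have hC : ∀ w : ℂ, 0 < w.im →
      Tendsto (fun n => ∫ x, G (booleMap^[n] x) ∂cauchyAt w) atTop (𝓝 l) := fun w hw => by
    refine (h.tendsto_integral_cauchyAt hG hb (tendsto_cOrbit_im hw)
      (tendsto_cOrbit_re_div_im hw)).congr fun n => ?_
    rw [← map_iterate_booleMap_cauchyAt hw,
      integral_map (hT n).aemeasurable hG.aestronglyMeasurable]
  have key := tendsto_integral_smul_of_forall_cauchyAt
    (Measure.integrable_toReal_rnDeriv (μ := ν) (ν := volume)) (fun n => hG.comp (hT n))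
    (fun n x => hb _) hC
  simp only [integral_rnDeriv_smul hν] at key
  have h1 : ∫ x, (ν.rnDeriv volume x).toReal = 1 := by
    rw [Measure.integral_toReal_rnDeriv hν]
    simp
  rw [h1, one_smul] at key
  exact key

/-! ### Characteristic functions and Lévy continuity. -/

theorem charFun_map_eq_integral_expObs {μ : Measure ℝ} {F : ℝ → ℝ} (hF : AEMeasurable F μ)
    (θ : ℝ) : charFun (μ.map F) θ = ∫ x, expObs F θ x ∂μ := by
  rw [charFun_apply_real, integral_map hF (by fun_prop)]
  refine integral_congr_ae (ae_of_all _ fun x => ?_)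
  simp only [expObs]
  congr 1
  ring

theorem HasAvg.congr_ae {G G' : ℝ → ℂ} {l : ℂ} (h : HasAvg G l) (hG : G =ᵐ[volume] G') :
    HasAvg G' l := by
  refine Tendsto.congr (fun a => ?_) h
  rw [intervalIntegral.integral_congr_ae (hG.mono fun x hx _ => hx)]

theorem quasiMeasurePreserving_iterate (n : ℕ) :
    Measure.QuasiMeasurePreserving booleMap^[n] volume volume :=
  quasiMeasurePreserving_booleMap.iterate n

theorem aemeasurable_comp_iterate {F : ℝ → ℝ} (hF : AEMeasurable F volume) {ν : Measure ℝ}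
    (hν : ν ≪ volume) (n : ℕ) : AEMeasurable (F ∘ booleMap^[n]) ν :=
  (hF.comp_quasiMeasurePreserving (quasiMeasurePreserving_iterate n)).mono_ac hν

theorem tendsto_charFun_map_iterate {F : ℝ → ℝ} (hF : AEMeasurable F volume) {θ : ℝ} {l : ℂ}
    (h : HasAvg (expObs F θ) l) (ν : Measure ℝ) [IsProbabilityMeasure ν] (hν : ν ≪ volume) :
    Tendsto (fun n => charFun (ν.map (F ∘ booleMap^[n])) θ) atTop (𝓝 l) := by
  obtain ⟨F', hF', hFF'⟩ := id hF
  have hae : expObs F θ =ᵐ[volume] expObs F' θ := by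
    filter_upwards [hFF'] with x hx
    simp only [expObs, hx]
  have hm : Measurable (expObs F' θ) := by
    unfold expObs
    fun_prop
  have hb : ∀ x, ‖expObs F' θ x‖ ≤ 1 := fun x => by
    have e : Complex.I * θ * (F' x : ℂ) = ((θ * F' x : ℝ) : ℂ) * Complex.I := by
      push_cast
      ring
    rw [expObs, e, Complex.norm_exp_ofReal_mul_I]
  refine ((h.congr_ae hae).tendsto_integral_iterate hm hb ν hν).congr fun n => ?_
  rw [charFun_map_eq_integral_expObs (aemeasurable_comp_iterate hF hν n)]
  exact (integral_congr_ae (hν.ae_le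
    ((quasiMeasurePreserving_iterate n).ae_eq_comp hae))).symm

/-- The existence part of Lévy's continuity theorem. -/
theorem exists_charFun_eq_of_tendsto_charFun {μ : ℕ → ProbabilityMeasure ℝ} {f : ℝ → ℂ}
    (hf : ContinuousAt f 0)
    (h : ∀ t, Tendsto (fun n => charFun (μ n : Measure ℝ) t) atTop (𝓝 (f t))) :
    ∃ μ₀ : ProbabilityMeasure ℝ, ∀ t, charFun (μ₀ : Measure ℝ) t = f t := by
  have ht : IsTightMeasureSet {((μ' : ProbabilityMeasure ℝ) : Measure ℝ) | μ' ∈ range μ} := by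
    convert! isTightMeasureSet_of_tendsto_charFun (μ := fun n => (μ n : Measure ℝ)) hf h
    ext ρ
    simp
  -- Prokhorov compactness gives a limit along a free ultrafilter, replacing extraction of a
  -- subsequence.
  obtain ⟨μ₀, -, hμ₀⟩ := (isCompact_closure_of_isTightMeasureSet ht).ultrafilter_le_nhds
    ((hyperfilter ℕ).map μ) (.trans (by simp) (monotone_principal subset_closure))
  refine ⟨μ₀, fun t => ?_⟩
  have h1 : Tendsto μ (hyperfilter ℕ) (𝓝 μ₀) := hμ₀
  rw [ProbabilityMeasure.tendsto_iff_forall_integral_rclike_tendsto ℂ] at h1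
  have h2 := h1 (BoundedContinuousFunction.innerProbChar t)
  simp only [← charFun_eq_integral_innerProbChar] at h2
  exact tendsto_nhds_unique h2 ((h t).mono_left Nat.hyperfilter_le_atTop)

end Boole

end

theorem proposition3p2 (F : ℝ → ℝ) (hF : AEMeasurable F volume)
    (havg : ∀ θ : ℝ, ∃ l : ℂ, Boole.HasAvg (Boole.expObs F θ) l) :
    (∀ {Ω : Type*} [MeasurableSpace Ω] (P : Measure Ω) [IsProbabilityMeasure P] (X : Ω → ℝ),
        Boole.IsRandomVariableWithCharFun P X (fun θ => Boole.avg (Boole.expObs F θ)) →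
        Boole.TendstoStrongDistrib (fun n => F ∘ Boole.booleMap^[n]) P X) ∧
    ((∃ (Ω : Type) (_ : MeasurableSpace Ω) (P : Measure Ω) (_ : IsProbabilityMeasure P)
        (X : Ω → ℝ),
        Boole.IsRandomVariableWithCharFun P X (fun θ => Boole.avg (Boole.expObs F θ))) ↔
      ContinuousAt (fun θ : ℝ => Boole.avg (Boole.expObs F θ)) 0) := by
  have havg' : ∀ θ, Boole.HasAvg (Boole.expObs F θ) (Boole.avg (Boole.expObs F θ)) := fun θ => by
    obtain ⟨l, hl⟩ := havg θ
    rwa [hl.avg_eq]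
  refine ⟨?_, ?_, ?_⟩
  · intro Ω _ P _ X hX ν _ hν
    refine ⟨fun n => Boole.aemeasurable_comp_iterate hF hν n, hX.1.aemeasurable, ?_⟩
    refine ProbabilityMeasure.tendsto_of_tendsto_charFun fun θ => ?_
    have h := Boole.tendsto_charFun_map_iterate hF (havg' θ) ν hν
    exact (hX.2 θ : _ = Boole.avg _) ▸ h
  · rintro ⟨Ω, _, P, _, X, hX, hφ⟩
    have : IsProbabilityMeasure (P.map X) := Measure.isProbabilityMeasure_map hX.aemeasurable
    have e : (fun θ : ℝ => Boole.avg (Boole.expObs F θ)) = charFun (P.map X) :=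
      funext fun θ => (hφ θ).symm
    rw [e]
    exact continuous_charFun.continuousAt
  · intro hc
    -- Any absolutely continuous initial probability would serve here.
    have hν : Boole.cauchyAt Complex.I ≪ volume :=
      Boole.cauchyAt_absolutelyContinuous (by simp)
    obtain ⟨μ₀, hμ₀⟩ := Boole.exists_charFun_eq_of_tendsto_charFun
      (μ := fun n => ⟨(Boole.cauchyAt Complex.I).map (F ∘ Boole.booleMap^[n]),
        Measure.isProbabilityMeasure_map (Boole.aemeasurable_comp_iterate hF hν n)⟩) hc
      (fun θ => Boole.tendsto_charFun_map_iterate hF (havg' θ) _ hν)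
    exact ⟨ℝ, inferInstance, μ₀, inferInstance, id, measurable_id, fun θ => by
      rw [Measure.map_id]
      exact hμ₀ θ⟩
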